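/- Let $F_m$ be the free group on $m$ free generators, let $\gamma_1(F_m)=F_m$, $\gamma_{n+1}(F_m)=[\gamma_n(F_m),F_m]$ be its lower central series, and let $H'=[H,H]$ denote the derived subgroup of a group $H$. For a group $G$ with a finite generating set $A$, let $B(n)$ be the set of elements of $G$ that can be written as words of length at most $n$ in $A\cup A^{-1}$; the growth rate of $(G,A)$ is $\omega(G,A)=\lim_{n\to\infty}|B(n)|^{1/n}$. (1) For every integer $m\ge 1$ and every $\varepsilon>0$ there is an $n\ge 2$ such that the group $G=F_m/\gamma_n(F_m)'$, with the set $A$ of the images of the $m$ free generators (which are $m$ distinct elements generating $G$), is amenable, is an extension of an abelian group by a nilpotent group (that is, has an abelian normal subgroup with nilpotent quotient), and has growth rate $\omega(G,A)\ge 2m-1-\varepsilon$ (in particular the limit exists). Thus there is an $m$-generated amenable abelian-by-nilpotent group with growth rate at least $2m-1-\varepsilon$. (2) Consequently de la Harpe's question has a negative answer: for no integer $m\ge 2$ is there a constant $c_m$ with $1<c_m<2m-1$ such that every group $G$ with a generating set $A$ of $m$ elements and $\omega(G,A)\ge c_m$ is non-amenable. -/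

import Mathlib

open Filter Topology

/-- Word length of `g` with respect to `A`: the least length of a word in the alphabet `A ∪ A⁻¹`
representing `g` (and `⊤` if there is no such word, i.e. if `g` is not in the subgroup generated
by `A`). -/
noncomputable def wordLength {G : Type*} [Group G] (A : Set G) (g : G) : ℕ∞ :=
  ⨅ (w : List G) (_ : (∀ x ∈ w, x ∈ A ∨ x⁻¹ ∈ A) ∧ w.prod = g), (w.length : ℕ∞)

/-- The ball of radius `n` around the identity in the word metric given by `A`. -/
def wordBall {G : Type*} [Group G] (A : Set G) (n : ℕ) : Set G :=
  {g | wordLength A g ≤ n}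

/-- `ω` is the growth rate of the pair `(G, A)`: the limit of the `n`-th roots of the sizes of the
balls of radius `n` exists and equals `ω`. Only used for finite `A`, where all balls are finite. -/
def HasGrowthRate {G : Type*} [Group G] (A : Set G) (ω : ℝ) : Prop :=
  Tendsto (fun n : ℕ => ((wordBall A n).ncard : ℝ) ^ (1 / (n : ℝ))) atTop (𝓝 ω)

/-- A real function is bounded, i.e. is an element of `ℓ^∞(G)`. -/
def IsBoundedFun {G : Type*} (f : G → ℝ) : Prop := ∃ C : ℝ, ∀ x, |f x| ≤ C

/-- `M` restricts to a left-invariant mean on the space `ℓ^∞(G)` of bounded real functions: a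
linear, positive, normalized and left-invariant functional. The values of `M` on unbounded
functions carry no information. -/
structure IsInvariantMean {G : Type*} [Group G] (M : (G → ℝ) → ℝ) : Prop where
  map_add : ∀ f₁ f₂ : G → ℝ, IsBoundedFun f₁ → IsBoundedFun f₂ →
    M (fun x => f₁ x + f₂ x) = M f₁ + M f₂
  map_smul : ∀ (c : ℝ) (f : G → ℝ), IsBoundedFun f → M (fun x => c * f x) = c * M f
  nonneg : ∀ f : G → ℝ, IsBoundedFun f → (∀ x, 0 ≤ f x) → 0 ≤ M f
  map_one : M (fun _ => 1) = 1
  map_translate : ∀ (g : G) (f : G → ℝ), IsBoundedFun f → M (fun x => f (g * x)) = M f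

/-- A (discrete) group is amenable if it has a left-invariant mean on bounded functions. -/
def IsAmenableGroup (G : Type*) [Group G] : Prop :=
  ∃ M : (G → ℝ) → ℝ, IsInvariantMean M

/-- `G` is an extension of an abelian group (the normal subgroup) by a nilpotent group (the
quotient). -/
def IsAbelianByNilpotent (G : Type*) [Group G] : Prop :=
  ∃ (N : Subgroup G) (_ : N.Normal), IsMulCommutative N ∧ Group.IsNilpotent (G ⧸ N)

/-- The `n`-th term `γ_n(F_m)` of the lower central series of the free group of rank `m`, indexed
as usual so that `γ_1(F_m) = F_m` and `γ_{n+1}(F_m) = [γ_n(F_m), F_m]` for `n ≥ 1`. -/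
abbrev freeGamma (m n : ℕ) : Subgroup (FreeGroup (Fin m)) :=
  (⊤ : Subgroup (FreeGroup (Fin m))).lowerCentralSeries (n - 1)

/-- The group `F_m / γ_n(F_m)'`, the quotient by the derived subgroup of `γ_n(F_m)`. -/
abbrev FreeAbByNil (m n : ℕ) : Type :=
  FreeGroup (Fin m) ⧸ ⁅freeGamma m n, freeGamma m n⁆

/-- The natural generating set of `F_m / γ_n(F_m)'`: the images of the free generators. -/
def freeAbByNilGens (m n : ℕ) : Set (FreeAbByNil m n) :=
  Set.range fun i : Fin m => (QuotientGroup.mk (FreeGroup.of i) : FreeAbByNil m n)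

/-! Elements of `F_m / N'`, with `N = γ_n(F_m)`, can be told apart by flows: a word traces a path in
the Cayley graph of `F_m / N`, and its net number of passages through each edge with a fixed label
`a` depends only on its class modulo `N'`. The proof finds almost `(2m-1)^L` words of length about
`L` whose products all have different flows.

Reduced words that start with `a` and do not end with `a⁻¹` concatenate without cancellation. By
pigeonhole on the exponent sum of `a`, at the cost of a linear factor, and by inversion if
necessary, one gets a set `V` of elements of norm at most `b` with common exponent sum `c ≥ 0` and
`|V| > r ^ b`, whose products of equal length determine their factors; here `r < 2m - 1` is
arbitrary. The stems `a^b v₁⋯v_s a^(b+1)` climb from height `0` to a common height `D`, using only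
`a`-edges that start in `[0, D)`. In a product of blocks stem·`a`, the only `a`-edge at height `D`
is the one right after the first stem, so the flow reveals where that stem ends in `F_m / N`. Free
groups are residually nilpotent and there are finitely many stems, so for large `n` this endpoint
determines the stem; cancel and repeat (`eq_of_flowHom_prod_eq`).

Thus `|V|^(sk)` elements lie in a ball of radius `k((s+2)b+2)`, and for large `s` the overhead
`2b+2` is negligible. The growth rate exists by Fekete's lemma, and amenability holds because the
group is abelian-by-nilpotent. The second claim is the first with `ε = 2m - 1 - c`. -/

section Amenability

/-! ### Invariant means and the amenability of solvable groups. -/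

theorem IsBoundedFun.add {X : Type*} {f g : X → ℝ} (hf : IsBoundedFun f) (hg : IsBoundedFun g) :
    IsBoundedFun fun x => f x + g x := by
  obtain ⟨C, hC⟩ := hf
  obtain ⟨D, hD⟩ := hg
  exact ⟨C + D, fun x => (abs_add_le _ _).trans (add_le_add (hC x) (hD x))⟩

theorem IsBoundedFun.const_mul {X : Type*} {f : X → ℝ} (c : ℝ) (hf : IsBoundedFun f) :
    IsBoundedFun fun x => c * f x := by
  obtain ⟨C, hC⟩ := hf
  exact ⟨|c| * C, fun x => by rw [abs_mul]; exact mul_le_mul_of_nonneg_left (hC x) (abs_nonneg c)⟩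

theorem IsBoundedFun.comp {X Y : Type*} {f : Y → ℝ} (hf : IsBoundedFun f) (φ : X → Y) :
    IsBoundedFun fun x => f (φ x) := by
  obtain ⟨C, hC⟩ := hf
  exact ⟨C, fun x => hC _⟩

theorem isBoundedFun_const {X : Type*} (c : ℝ) : IsBoundedFun fun _ : X => c := ⟨|c|, fun _ => le_rfl⟩

/-- A mean on the bounded functions on `X`. -/
structure IsMean {X : Type*} (M : (X → ℝ) → ℝ) : Prop where
  map_add : ∀ f₁ f₂ : X → ℝ, IsBoundedFun f₁ → IsBoundedFun f₂ →
    M (fun x => f₁ x + f₂ x) = M f₁ + M f₂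
  map_smul : ∀ (c : ℝ) (f : X → ℝ), IsBoundedFun f → M (fun x => c * f x) = c * M f
  nonneg : ∀ f : X → ℝ, IsBoundedFun f → (∀ x, 0 ≤ f x) → 0 ≤ M f
  map_one : M (fun _ => 1) = 1

namespace IsMean

variable {X : Type*} {M : (X → ℝ) → ℝ}

theorem map_const (hM : IsMean M) (c : ℝ) : M (fun _ => c) = c := by
  have := hM.map_smul c (fun _ => 1) (isBoundedFun_const 1)
  simpa [hM.map_one] using this

theorem mono (hM : IsMean M) {f g : X → ℝ} (hf : IsBoundedFun f) (hg : IsBoundedFun g)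
    (h : ∀ x, f x ≤ g x) : M f ≤ M g := by
  have h1 := hM.map_add f (fun x => g x + (-1) * f x) hf (hg.add (hf.const_mul _))
  have h2 := hM.nonneg (fun x => g x + (-1) * f x) (hg.add (hf.const_mul _))
    fun x => by linarith [h x]
  have h3 : (fun x => f x + (g x + (-1) * f x)) = g := by ext x; ring
  rw [h3] at h1
  linarith

theorem abs_le (hM : IsMean M) {f : X → ℝ} {C : ℝ} (h : ∀ x, |f x| ≤ C) : |M f| ≤ C := by
  rw [_root_.abs_le]
  constructor
  · rw [← hM.map_const (-C)]
    exact hM.mono (isBoundedFun_const _) ⟨C, h⟩ fun x => (_root_.abs_le.1 (h x)).1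
  · rw [← hM.map_const C]
    exact hM.mono ⟨C, h⟩ (isBoundedFun_const _) fun x => (_root_.abs_le.1 (h x)).2

end IsMean

/-- Along every nontrivial filter there is a mean which extends the limit. -/
theorem exists_isMean_of_tendsto {ι : Type*} (l : Filter ι) [l.NeBot] :
    ∃ Λ : (ι → ℝ) → ℝ, IsMean Λ ∧ ∀ (u : ι → ℝ) (a : ℝ), Tendsto u l (𝓝 a) → Λ u = a := by
  let U : Ultrafilter ι := Ultrafilter.of l
  have hU : (U : Filter ι) ≤ l := Ultrafilter.of_le l
  have key : ∀ u : ι → ℝ, IsBoundedFun u → Tendsto u U (𝓝 (limUnder (U : Filter ι) u)) := by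
    rintro u ⟨C, hC⟩
    have : ∃ a ∈ Set.Icc (-C) C, ((U.map u : Ultrafilter ℝ) : Filter ℝ) ≤ 𝓝 a := by
      refine isCompact_Icc.ultrafilter_le_nhds _ ?_
      rw [le_principal_iff]
      exact Ultrafilter.mem_map.2 (Eventually.of_forall fun i => _root_.abs_le.1 (hC i))
    obtain ⟨a, -, ha⟩ := this
    exact tendsto_nhds_limUnder ⟨a, ha⟩
  refine ⟨fun u => limUnder (U : Filter ι) u, ⟨?_, ?_, ?_, ?_⟩, ?_⟩
  · intro f g hf hg
    exact ((key f hf).add (key g hg)).limUnder_eq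
  · intro c f hf
    exact ((key f hf).const_mul c).limUnder_eq
  · intro f hf h
    exact ge_of_tendsto' (key f hf) h
  · exact tendsto_const_nhds.limUnder_eq
  · intro u a h
    exact (h.mono_left hU).limUnder_eq

/-- Averaging a family of means with respect to a mean on the index set. -/
theorem IsMean.bind {ι X : Type*} {Λ : (ι → ℝ) → ℝ} (hΛ : IsMean Λ) {M : ι → (X → ℝ) → ℝ}
    (hM : ∀ i, IsMean (M i)) : IsMean fun f => Λ fun i => M i f := by
  have hb : ∀ f : X → ℝ, IsBoundedFun f → IsBoundedFun fun i => M i f := by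
    rintro f ⟨C, hC⟩
    exact ⟨C, fun i => (hM i).abs_le hC⟩
  refine ⟨?_, ?_, ?_, ?_⟩
  · intro f g hf hg
    simp only [(hM _).map_add f g hf hg]
    exact hΛ.map_add _ _ (hb f hf) (hb g hg)
  · intro c f hf
    simp only [(hM _).map_smul c f hf]
    exact hΛ.map_smul _ _ (hb f hf)
  · intro f hf h
    exact hΛ.nonneg _ (hb f hf) fun i => (hM i).nonneg f hf h
  · simp only [(hM _).map_one]
    exact hΛ.map_one

theorem IsMean.comap {X Y : Type*} {M : (X → ℝ) → ℝ} (hM : IsMean M) (φ : X → Y) :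
    IsMean fun f : Y → ℝ => M fun x => f (φ x) :=
  ⟨fun _ _ hf hg => hM.map_add _ _ (hf.comp φ) (hg.comp φ),
    fun c _ hf => hM.map_smul c _ (hf.comp φ),
    fun _ hf h => hM.nonneg _ (hf.comp φ) fun _ => h _, hM.map_one⟩

/-- Invariance under the left translation by `g`. -/
def IsInvariantUnder {G : Type*} [Group G] (M : (G → ℝ) → ℝ) (g : G) : Prop :=
  ∀ f : G → ℝ, IsBoundedFun f → M (fun x => f (g * x)) = M f

theorem isAmenableGroup_iff {G : Type*} [Group G] :
    IsAmenableGroup G ↔ ∃ M : (G → ℝ) → ℝ, IsMean M ∧ ∀ g, IsInvariantUnder M g :=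
  ⟨fun ⟨M, h⟩ => ⟨M, ⟨h.map_add, h.map_smul, h.nonneg, h.map_one⟩, h.map_translate⟩,
    fun ⟨M, h, h'⟩ => ⟨M, h.map_add, h.map_smul, h.nonneg, h.map_one, h'⟩⟩

theorem isMean_eval {X : Type*} (x : X) : IsMean fun f : X → ℝ => f x :=
  ⟨fun _ _ _ _ => rfl, fun _ _ _ => rfl, fun _ _ h => h x, rfl⟩

theorem isMean_cesaro {X : Type*} (p : ℕ → X) (n : ℕ) :
    IsMean fun f : X → ℝ => (n + 1 : ℝ)⁻¹ * ∑ k ∈ Finset.range (n + 1), f (p k) := by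
  refine ⟨?_, ?_, ?_, ?_⟩
  · intro _ _ _ _
    rw [Finset.sum_add_distrib, mul_add]
  · intro c _ _
    rw [← Finset.mul_sum]
    ring
  · intro f _ h
    have := Finset.sum_nonneg (s := Finset.range (n + 1)) fun k _ => h (p k)
    positivity
  · have : (n + 1 : ℝ) ≠ 0 := by positivity
    simp [this]

/-- Cesàro averaging makes a mean invariant under one more commuting element. -/
theorem exists_isMean_invariantUnder {G : Type*} [Group G] (hG : ∀ a b : G, a * b = b * a)
    {M : (G → ℝ) → ℝ} (hM : IsMean M) (g : G) :
    ∃ M' : (G → ℝ) → ℝ, IsMean M' ∧ IsInvariantUnder M' g ∧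
      ∀ h, IsInvariantUnder M h → IsInvariantUnder M' h := by
  obtain ⟨Λ, hΛ, hlim⟩ := exists_isMean_of_tendsto (atTop : Filter ℕ)
  let T : ℕ → (G → ℝ) → ℝ := fun k f => M fun x => f (g ^ k * x)
  have hT : ∀ k, IsMean (T k) := fun k => hM.comap fun x => g ^ k * x
  let A : ℕ → (G → ℝ) → ℝ := fun n f => (n + 1 : ℝ)⁻¹ * ∑ k ∈ Finset.range (n + 1), T k f
  have hA : ∀ n, IsMean (A n) := fun n => (isMean_cesaro (fun k => k) n).bind hT
  refine ⟨fun f => Λ fun n => A n f, hΛ.bind hA, ?_, ?_⟩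
  · rintro f ⟨C, hC⟩
    have hb : IsBoundedFun fun n => A n f := ⟨C, fun n => (hA n).abs_le hC⟩
    have hb' : IsBoundedFun fun n => A n fun x => f (g * x) :=
      ⟨C, fun n => (hA n).abs_le fun x => hC _⟩
    have hshift : ∀ k, T k (fun x => f (g * x)) = T (k + 1) f := by
      intro k
      simp only [T, pow_succ', mul_assoc]
    -- The sum telescopes: only its two ends survive, and they are bounded by `C`.
    have hdiff : ∀ n, A n (fun x => f (g * x)) + (-1) * A n f
        = (n + 1 : ℝ)⁻¹ * (T (n + 1) f - T 0 f) := by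
      intro n
      simp only [A, hshift]
      rw [← Finset.sum_range_sub (fun k => T k f) (n + 1), Finset.sum_sub_distrib]
      ring
    have h0 : Λ (fun n => A n (fun x => f (g * x)) + (-1) * A n f) = 0 := by
      apply hlim
      simp only [hdiff]
      refine squeeze_zero_norm (a := fun n : ℕ => (n + 1 : ℝ)⁻¹ * (C + C)) ?_ ?_
      · intro n
        rw [norm_mul, norm_inv, Real.norm_of_nonneg (by positivity : (0 : ℝ) ≤ n + 1)]
        refine mul_le_mul_of_nonneg_left ?_ (by positivity)
        exact (norm_sub_le _ _).trans (add_le_add ((hT _).abs_le hC) ((hT _).abs_le hC))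
      · have : Tendsto (fun n : ℕ => (n + 1 : ℝ)⁻¹) atTop (𝓝 0) := by
          simpa using tendsto_one_div_add_atTop_nhds_zero_nat (𝕜 := ℝ)
        simpa using this.mul_const (C + C)
    rw [hΛ.map_add _ _ hb' (hb.const_mul _), hΛ.map_smul _ _ hb] at h0
    linarith
  · intro h hh f hf
    have : ∀ k, T k (fun x => f (h * x)) = T k f := by
      intro k
      have := hh (fun x => f (g ^ k * x)) (hf.comp _)
      simp only [T]
      rw [← this]
      congr 1
      ext x
      rw [← mul_assoc, ← mul_assoc, hG h]
    simp only [A, this]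

/-- Finitely many elements are treated one at a time; a limit of these means along the directed set
of finite subsets is invariant under everything, since each `g` eventually belongs to the subset. -/
theorem isAmenableGroup_of_comm {G : Type*} [Group G] (hG : ∀ a b : G, a * b = b * a) :
    IsAmenableGroup G := by
  classical
  rw [isAmenableGroup_iff]
  have key : ∀ S : Finset G, ∃ M : (G → ℝ) → ℝ, IsMean M ∧ ∀ g ∈ S, IsInvariantUnder M g := by
    intro S
    induction S using Finset.induction_on with
    | empty => exact ⟨_, isMean_eval 1, by simp⟩
    | insert g S _ ih =>
      obtain ⟨M, hM, hinv⟩ := ih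
      obtain ⟨M', hM', hg, hh⟩ := exists_isMean_invariantUnder hG hM g
      refine ⟨M', hM', fun h hmem => ?_⟩
      rcases Finset.mem_insert.1 hmem with rfl | hmem
      · exact hg
      · exact hh h (hinv h hmem)
  choose M hM hinv using key
  obtain ⟨Λ, hΛ, hlim⟩ := exists_isMean_of_tendsto (atTop : Filter (Finset G))
  refine ⟨fun f => Λ fun S => M S f, hΛ.bind hM, ?_⟩
  rintro g f ⟨C, hC⟩
  have hb : IsBoundedFun fun S => M S f := ⟨C, fun S => (hM S).abs_le hC⟩
  have hb' : IsBoundedFun fun S => M S fun x => f (g * x) :=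
    ⟨C, fun S => (hM S).abs_le fun x => hC _⟩
  have h0 : Λ (fun S => M S (fun x => f (g * x)) + (-1) * M S f) = 0 := by
    apply hlim
    refine tendsto_const_nhds.congr' ?_
    filter_upwards [eventually_ge_atTop {g}] with S hS
    rw [hinv S g (by simpa using hS) f ⟨C, hC⟩]
    ring
  rw [hΛ.map_add _ _ hb' (hb.const_mul _), hΛ.map_smul _ _ hb] at h0
  simp only
  linarith

/-- The mean of `N` averages `f` over each coset; by invariance the average does not depend on the
representative, so the mean of `G ⧸ N` can be applied to it. -/
theorem isAmenableGroup_of_normal {G : Type*} [Group G] (N : Subgroup G) [N.Normal]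
    (hN : IsAmenableGroup N) (hQ : IsAmenableGroup (G ⧸ N)) : IsAmenableGroup G := by
  rw [isAmenableGroup_iff] at *
  obtain ⟨M, hM, hinv⟩ := hN
  obtain ⟨Λ, hΛ, hΛinv⟩ := hQ
  let Φ : G → (G → ℝ) → ℝ := fun g f => M fun n => f (g * n)
  have hΦ : ∀ g, IsMean (Φ g) := fun g => hM.comap fun n : N => g * (n : G)
  have hcoset : ∀ f : G → ℝ, IsBoundedFun f → ∀ g g' : G, (g : G ⧸ N) = g' → Φ g f = Φ g' f := by
    intro f hf g g' h
    have hmem : g⁻¹ * g' ∈ N := QuotientGroup.eq.1 h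
    have := hinv ⟨g⁻¹ * g', hmem⟩ (fun n => f (g * n)) (hf.comp _)
    simp only [Φ]
    rw [← this]
    congr 1
    ext n
    simp [mul_assoc]
  refine ⟨fun f => Λ fun q => Φ q.out f, hΛ.bind fun q => hΦ q.out, ?_⟩
  rintro h f ⟨C, hC⟩
  have hf : IsBoundedFun f := ⟨C, hC⟩
  have := hΛinv (h : G ⧸ N) (fun q => Φ q.out f) ⟨C, fun q => (hΦ _).abs_le hC⟩
  refine Eq.trans ?_ this
  refine congrArg Λ (funext fun q => ?_)
  have h1 : Φ q.out (fun x => f (h * x)) = Φ (h * q.out) f := by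
    simp only [Φ, mul_assoc]
  rw [h1]
  apply hcoset f hf
  rw [QuotientGroup.mk_mul, QuotientGroup.out_eq', QuotientGroup.out_eq']

theorem isAmenableGroup_of_isSolvable {G : Type*} [Group G] [h : Group.IsSolvable G] :
    IsAmenableGroup G := by
  obtain ⟨n, hn⟩ := h.solvable
  clear h
  induction n generalizing G with
  | zero =>
    rw [derivedSeries_zero] at hn
    have := Subgroup.subsingleton_iff.1 (subsingleton_of_bot_eq_top hn.symm)
    exact isAmenableGroup_of_comm fun a b => Subsingleton.elim _ _
  | succ n ih =>
    have hnorm : (derivedSeries G n).Normal := derivedSeries_normal G n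
    refine isAmenableGroup_of_normal (derivedSeries G n) (isAmenableGroup_of_comm ?_) (ih ?_)
    · intro a b
      rw [derivedSeries_succ] at hn
      have := Subgroup.commutator_mem_commutator a.2 b.2
      rw [hn, Subgroup.mem_bot, commutatorElement_eq_one_iff_mul_comm] at this
      exact Subtype.ext this
    · rw [← map_derivedSeries_eq (QuotientGroup.mk'_surjective (derivedSeries G n)),
        Subgroup.map_eq_bot_iff, QuotientGroup.ker_mk']

end Amenability

/-! ### Residual nilpotence of free groups, by unipotent integral matrices. -/

section ResidualNilpotence

open scoped commutatorElement

namespace Matrix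

variable {l : ℕ}

/-- The matrix vanishes below the `n`-th superdiagonal. -/
def VanishesBelow (n : ℕ) (M : Matrix (Fin l) (Fin l) ℤ) : Prop :=
  ∀ i j, M i j ≠ 0 → i.val + n ≤ j.val

namespace VanishesBelow

theorem mul {a b : ℕ} {M N : Matrix (Fin l) (Fin l) ℤ} (hM : VanishesBelow a M)
    (hN : VanishesBelow b N) : VanishesBelow (a + b) (M * N) := by
  intro i j h
  rw [mul_apply] at h
  obtain ⟨k, -, hk⟩ := Finset.exists_ne_zero_of_sum_ne_zero h
  have h1 := hM i k (left_ne_zero_of_mul hk)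
  have h2 := hN k j (right_ne_zero_of_mul hk)
  omega

theorem add {a : ℕ} {M N : Matrix (Fin l) (Fin l) ℤ} (hM : VanishesBelow a M)
    (hN : VanishesBelow a N) : VanishesBelow a (M + N) := by
  intro i j h
  by_cases h1 : M i j = 0
  · exact hN i j (by simpa [h1] using h)
  · exact hM i j h1

theorem neg {a : ℕ} {M : Matrix (Fin l) (Fin l) ℤ} (hM : VanishesBelow a M) :
    VanishesBelow a (-M) := fun i j h => hM i j (by simpa using h)

theorem sub {a : ℕ} {M N : Matrix (Fin l) (Fin l) ℤ} (hM : VanishesBelow a M)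
    (hN : VanishesBelow a N) : VanishesBelow a (M - N) := by
  rw [sub_eq_add_neg]
  exact hM.add hN.neg

theorem mono {a b : ℕ} (h : b ≤ a) {M : Matrix (Fin l) (Fin l) ℤ} (hM : VanishesBelow a M) :
    VanishesBelow b M := fun i j hij => by
  have := hM i j hij
  omega

theorem one : VanishesBelow 0 (1 : Matrix (Fin l) (Fin l) ℤ) := by
  intro i j h
  by_contra hij
  exact h (one_apply_ne fun e => hij (by simp [e]))

theorem zero (a : ℕ) : VanishesBelow a (0 : Matrix (Fin l) (Fin l) ℤ) := fun _ _ h => (h rfl).elim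

theorem pow {M : Matrix (Fin l) (Fin l) ℤ} (hM : VanishesBelow 1 M) (k : ℕ) :
    VanishesBelow k (M ^ k) := by
  induction k with
  | zero => simpa using one
  | succ k ih =>
    rw [pow_succ]
    exact ih.mul hM

theorem sum {a : ℕ} {ι : Type*} (s : Finset ι) {f : ι → Matrix (Fin l) (Fin l) ℤ}
    (h : ∀ i ∈ s, VanishesBelow a (f i)) : VanishesBelow a (∑ i ∈ s, f i) :=
  Finset.sum_induction _ _ (fun _ _ => add) (zero a) h

theorem eq_zero {a : ℕ} (ha : l ≤ a) {M : Matrix (Fin l) (Fin l) ℤ} (hM : VanishesBelow a M) :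
    M = 0 := by
  ext i j
  by_contra h
  have := hM i j h
  omega

/-- The unipotent unit `1 + M` for a strictly upper triangular matrix `M`. -/
def oneAdd {M : Matrix (Fin l) (Fin l) ℤ} (hM : VanishesBelow 1 M) :
    (Matrix (Fin l) (Fin l) ℤ)ˣ where
  val := 1 + M
  -- The geometric series stops because `M ^ l = 0`.
  inv := ∑ k ∈ Finset.range l, (-M) ^ k
  val_inv := by
    have h := mul_neg_geom_sum (-M) l
    rwa [(hM.neg.pow l).eq_zero le_rfl, sub_zero, sub_neg_eq_add] at h
  inv_val := by
    have h := geom_sum_mul_neg (-M) l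
    rwa [(hM.neg.pow l).eq_zero le_rfl, sub_zero, sub_neg_eq_add] at h

end VanishesBelow

/-- The group of invertible integral matrices which agree with the identity matrix below the
`n`-th superdiagonal. -/
def unipotentSubgroup (l n : ℕ) : Subgroup (Matrix (Fin l) (Fin l) ℤ)ˣ where
  carrier := {g | VanishesBelow n (g.val - 1) ∧ VanishesBelow n (g⁻¹.val - 1)}
  one_mem' := by simpa using VanishesBelow.zero n
  mul_mem' := by
    have key : ∀ a b : Matrix (Fin l) (Fin l) ℤ, VanishesBelow n (a - 1) → VanishesBelow n (b - 1) →
        VanishesBelow n (a * b - 1) := by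
      intro a b ha hb
      have : a * b - 1 = (a - 1) * (b - 1) + ((a - 1) + (b - 1)) := by noncomm_ring
      rw [this]
      exact ((ha.mul hb).mono (by omega)).add (ha.add hb)
    rintro a b ⟨ha, ha'⟩ ⟨hb, hb'⟩
    refine ⟨key _ _ ha hb, ?_⟩
    rw [_root_.mul_inv_rev]
    exact key _ _ hb' ha'
  inv_mem' := by
    rintro a ⟨ha, ha'⟩
    exact ⟨ha', by simpa using ha⟩

theorem VanishesBelow.oneAdd_mem {l : ℕ} {M : Matrix (Fin l) (Fin l) ℤ} (hM : VanishesBelow 1 M) :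
    hM.oneAdd ∈ unipotentSubgroup l 1 := by
  have h1 : VanishesBelow 1 (hM.oneAdd.val - 1) := by
    simpa [VanishesBelow.oneAdd] using hM
  refine ⟨h1, ?_⟩
  have h0 : VanishesBelow 0 hM.oneAdd⁻¹.val :=
    VanishesBelow.sum (Finset.range l) fun k _ => (hM.neg.pow k).mono (Nat.zero_le k)
  have : hM.oneAdd⁻¹.val - 1 = -((hM.oneAdd.val - 1) * hM.oneAdd⁻¹.val) := by
    rw [sub_mul, Units.mul_inv]
    noncomm_ring
  rw [this]
  exact (h1.mul h0).neg

theorem commutatorElement_mem_unipotentSubgroup {l a b : ℕ} {g h : (Matrix (Fin l) (Fin l) ℤ)ˣ}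
    (hg : g ∈ unipotentSubgroup l a) (hh : h ∈ unipotentSubgroup l b) :
    ⁅g, h⁆ ∈ unipotentSubgroup l (a + b) := by
  have key : ∀ {a b : ℕ} {g h : (Matrix (Fin l) (Fin l) ℤ)ˣ}, g ∈ unipotentSubgroup l a →
      h ∈ unipotentSubgroup l b → VanishesBelow (a + b) (⁅g, h⁆.val - 1) := by
    intro a b g h hg hh
    -- Both products on the right vanish below superdiagonal `a + b`, and the last factor is upper
    -- triangular.
    have hid : ⁅g, h⁆.val - 1
        = ((g.val - 1) * (h.val - 1) - (h.val - 1) * (g.val - 1)) * (g⁻¹.val * h⁻¹.val) := by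
      have h1 : (g.val - 1) * (h.val - 1) - (h.val - 1) * (g.val - 1)
          = g.val * h.val - h.val * g.val := by noncomm_ring
      have h2 : h.val * g.val * (g⁻¹.val * h⁻¹.val) = 1 := by
        rw [← Units.val_mul, ← Units.val_mul, ← Units.val_mul]
        simp
      rw [h1, sub_mul, h2, commutatorElement_def]
      simp [mul_assoc]
    have h0 : ∀ {n : ℕ} {g : (Matrix (Fin l) (Fin l) ℤ)ˣ}, g ∈ unipotentSubgroup l n →
        VanishesBelow 0 g⁻¹.val := by
      intro n g hg
      have := (hg.2.mono (Nat.zero_le n)).add VanishesBelow.one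
      rwa [sub_add_cancel] at this
    rw [hid]
    refine VanishesBelow.mul (b := 0) ?_ ((h0 hg).mul (h0 hh))
    exact (hg.1.mul hh.1).sub (by rw [add_comm]; exact hh.1.mul hg.1)
  refine ⟨key hg hh, ?_⟩
  rw [commutatorElement_inv, add_comm]
  exact key hh hg

end Matrix

open Matrix

theorem lowerCentralSeries_le_comap_unipotentSubgroup {G : Type*} [Group G] {l : ℕ}
    (ρ : G →* (Matrix (Fin l) (Fin l) ℤ)ˣ) (hρ : ∀ g, ρ g ∈ unipotentSubgroup l 1) (n : ℕ) :
    (⊤ : Subgroup G).lowerCentralSeries n ≤ (unipotentSubgroup l (n + 1)).comap ρ := by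
  induction n with
  | zero => exact fun g _ => hρ g
  | succ n ih =>
    rw [Subgroup.lowerCentralSeries_succ, Subgroup.commutator_le]
    intro g hg h _
    rw [Subgroup.mem_comap, map_commutatorElement]
    exact commutatorElement_mem_unipotentSubgroup (ih hg) (hρ h)

namespace FreeGroup

variable {α : Type*}

open Classical in
/-- The superdiagonal matrix marking the positions at which the letter `p` occurs in `w`. -/
noncomputable def letterMatrix (w : List (α × Bool)) (p : α × Bool) :
    Matrix (Fin (w.length + 1)) (Fin (w.length + 1)) ℤ :=
  fun i j => if i.val + 1 = j.val ∧ w[i.val]? = some p then 1 else 0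

theorem letterMatrix_vanishesBelow (w : List (α × Bool)) (p : α × Bool) :
    VanishesBelow 1 (letterMatrix w p) := by
  intro i j h
  unfold letterMatrix at h
  split_ifs at h with h'
  · exact h'.1.le
  · exact (h rfl).elim

/-- The unipotent representation of the free group associated with a word. -/
noncomputable def wordRep (w : List (α × Bool)) :
    FreeGroup α →* (Matrix (Fin (w.length + 1)) (Fin (w.length + 1)) ℤ)ˣ :=
  FreeGroup.lift fun a => (letterMatrix_vanishesBelow w (a, true)).oneAdd *
    (letterMatrix_vanishesBelow w (a, false)).oneAdd⁻¹

/-- The formula is the same for a generator and for an inverse, so later arguments need not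
distinguish signs. -/
theorem wordRep_letter (w : List (α × Bool)) (p : α × Bool) :
    wordRep w (mk [p]) = (letterMatrix_vanishesBelow w p).oneAdd *
      (letterMatrix_vanishesBelow w (p.1, !p.2)).oneAdd⁻¹ := by
  obtain ⟨a, b⟩ := p
  cases b <;> simp [wordRep, lift_mk]

theorem wordRep_mem (w : List (α × Bool)) (g : FreeGroup α) :
    wordRep w g ∈ unipotentSubgroup (w.length + 1) 1 := by
  induction g using FreeGroup.induction_on with
  | C1 => rw [_root_.map_one]; exact one_mem _
  | of a =>
    simp only [wordRep, lift_apply_of]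
    exact mul_mem (VanishesBelow.oneAdd_mem _) (inv_mem (VanishesBelow.oneAdd_mem _))
  | inv_of a h => rw [_root_.map_inv]; exact inv_mem h
  | mul a b ha hb => rw [_root_.map_mul]; exact mul_mem ha hb

open Classical in
theorem vecMul_oneAdd_succ (w : List (α × Bool)) (p : α × Bool) (v : Fin (w.length + 1) → ℤ)
    (j : ℕ) (hj : j + 1 < w.length + 1) :
    (v ᵥ* (letterMatrix_vanishesBelow w p).oneAdd.val) ⟨j + 1, hj⟩
      = v ⟨j + 1, hj⟩ + if w[j]? = some p then v ⟨j, by omega⟩ else 0 := by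
  simp only [VanishesBelow.oneAdd, vecMul_add, vecMul_one, Pi.add_apply, add_right_inj]
  rw [vecMul, dotProduct, Finset.sum_eq_single ⟨j, by omega⟩]
  · simp [letterMatrix]
  · intro i _ hi
    have : ¬ (i.val = j) := fun h => hi (Fin.ext h)
    simp [letterMatrix, this]
  · simp

/-- The vector has last nonzero entry `1` at position `t`. -/
def EndsAt {l : ℕ} (v : Fin l → ℤ) (t : ℕ) : Prop :=
  ∀ j : Fin l, (j.val = t → v j = 1) ∧ (t < j.val → v j = 0)

/-- The factor for `p` carries the entry at `t` to `t + 1` because `w` has the letter `p` there. The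
factor for the inverse letter `q` carries nothing further, since `w` is reduced and so `q` does not
follow `p`. -/
theorem endsAt_vecMul_letter {w : List (α × Bool)} (hw : IsReduced w)
    {v : Fin (w.length + 1) → ℤ} {t : ℕ} {p : α × Bool} (hp : w[t]? = some p) (hv : EndsAt v t) :
    EndsAt (v ᵥ* (wordRep w (mk [p])).val) (t + 1) := by
  classical
  set q : α × Bool := (p.1, !p.2) with hq
  set u := v ᵥ* (wordRep w (mk [p])).val with hu
  have hpq : p ≠ q := by
    intro h
    have := congrArg Prod.snd h
    simp [hq] at this
  have hnext : w[t + 1]? ≠ some q := by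
    intro h
    rw [IsReduced, List.isChain_iff_getElem] at hw
    obtain ⟨h1, h2⟩ := List.getElem?_eq_some_iff.1 h
    obtain ⟨h3, h4⟩ := List.getElem?_eq_some_iff.1 hp
    have := hw t h1
    rw [h2, h4] at this
    simp [hq] at this
  -- Moving the inverse factor to the other side gives a recursion for the entries of `u`.
  have heq : u ᵥ* (letterMatrix_vanishesBelow w q).oneAdd.val
      = v ᵥ* (letterMatrix_vanishesBelow w p).oneAdd.val := by
    rw [hu, wordRep_letter, vecMul_vecMul, ← Units.val_mul, inv_mul_cancel_right]
  have main : ∀ j (hj : j < w.length + 1), (j = t + 1 → u ⟨j, hj⟩ = 1) ∧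
      (t + 1 < j → u ⟨j, hj⟩ = 0) := by
    intro j
    induction j with
    | zero => intro hj; omega
    | succ j ih =>
      intro hj
      have h := congrFun heq ⟨j + 1, hj⟩
      rw [vecMul_oneAdd_succ, vecMul_oneAdd_succ] at h
      constructor
      · intro hjt
        obtain rfl : j = t := by omega
        rw [hp, if_neg (by simpa using hpq), if_pos rfl, (hv _).2 (by simp), (hv _).1 rfl] at h
        simpa using h
      · intro hjt
        have hz : (if w[j]? = some q then u ⟨j, by omega⟩ else 0) = 0 := by
          by_cases hj1 : j = t + 1
          · exact if_neg (by rwa [hj1])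
          · rw [(ih (by omega)).2 (by omega), ite_self]
        have hz' : (if w[j]? = some p then v ⟨j, by omega⟩ else 0) = 0 := by
          rw [(hv _).2 (by simp; omega), ite_self]
        rw [hz, hz', (hv _).2 (by simp; omega)] at h
        simpa using h
  exact fun j => main j.val j.isLt

theorem endsAt_wordRep {w : List (α × Bool)} (hw : IsReduced w) (t : ℕ) (ht : t ≤ w.length) :
    EndsAt ((Pi.single 0 1 : Fin (w.length + 1) → ℤ) ᵥ* (wordRep w (mk (w.take t))).val) t := by
  induction t with
  | zero =>
    intro j
    rw [List.take_zero, ← one_eq_mk, _root_.map_one, Units.val_one, vecMul_one]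
    refine ⟨fun h => ?_, fun h => ?_⟩
    · obtain rfl : j = 0 := Fin.ext h
      simp
    · rw [Pi.single_apply, if_neg]
      rintro rfl
      simp at h
  | succ t ih =>
    have hp : w[t]? = some w[t] := List.getElem?_eq_getElem ht
    have := endsAt_vecMul_letter hw hp (ih (by omega))
    rw [vecMul_vecMul, ← Units.val_mul, ← _root_.map_mul, mul_mk] at this
    rwa [List.take_add_one, hp]

/-- Free groups are residually nilpotent. -/
theorem exists_notMem_lowerCentralSeries {g : FreeGroup α} (hg : g ≠ 1) :
    ∃ n, g ∉ (⊤ : Subgroup (FreeGroup α)).lowerCentralSeries n := by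
  classical
  set w := g.toWord with hw
  refine ⟨w.length, fun hmem => ?_⟩
  -- The level reached is `w.length + 1`, the size of the matrices, so `g` would act trivially; yet
  -- it moves the first basis row vector.
  have h1 := lowerCentralSeries_le_comap_unipotentSubgroup (wordRep w) (wordRep_mem w) _ hmem
  have h2 : wordRep w g = 1 := Units.ext (sub_eq_zero.1 (h1.1.eq_zero le_rfl))
  have hred : IsReduced w := isReduced_toWord
  have hmk : mk w = g := mk_toWord
  have h3 := (endsAt_wordRep hred w.length le_rfl ⟨w.length, Nat.lt_succ_self _⟩).1 rfl
  rw [List.take_length, hmk, h2, Units.val_one, vecMul_one, Pi.single_apply,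
    if_neg] at h3
  · exact zero_ne_one h3
  · intro h
    have : w.length = 0 := congrArg Fin.val h
    exact hg (toWord_eq_nil_iff.1 (List.length_eq_zero_iff.1 this))

theorem exists_lowerCentralSeries_disjoint_finset (S : Finset (FreeGroup α)) :
    ∃ n, ∀ k, n ≤ k → ∀ g ∈ S, g ∈ (⊤ : Subgroup (FreeGroup α)).lowerCentralSeries k → g = 1 := by
  classical
  induction S using Finset.induction_on with
  | empty => simp
  | insert a S _ ih =>
    obtain ⟨n, hn⟩ := ih
    by_cases ha : a = 1
    · refine ⟨n, fun k hk g hg hmem => ?_⟩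
      rcases Finset.mem_insert.1 hg with rfl | hg
      · exact ha
      · exact hn k hk g hg hmem
    · obtain ⟨n', hn'⟩ := exists_notMem_lowerCentralSeries ha
      refine ⟨max n n', fun k hk g hg hmem => ?_⟩
      rcases Finset.mem_insert.1 hg with rfl | hg
      · exact (hn' (Subgroup.lowerCentralSeries_antitone _ (le_of_max_le_right hk) hmem)).elim
      · exact hn k (le_of_max_le_left hk) g hg hmem

end FreeGroup

end ResidualNilpotence

/-! ### Word balls and the existence of the growth rate. -/

section Growth

variable {G : Type*} [Group G] {A : Set G}

theorem mem_wordBall_iff {n : ℕ} {g : G} :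
    g ∈ wordBall A n ↔ ∃ w : List G, (∀ x ∈ w, x ∈ A ∨ x⁻¹ ∈ A) ∧ w.prod = g ∧ w.length ≤ n := by
  -- A strict bound on an infimum yields a witness.
  have h : wordLength A g ≤ n ↔ wordLength A g < ((n + 1 : ℕ) : ℕ∞) := by
    rw [Nat.cast_add, Nat.cast_one, ENat.lt_add_one_iff (ENat.natCast_ne_top n)]
  rw [wordBall, Set.mem_ofPred_eq, h]
  unfold wordLength
  simp only [iInf_lt_iff, Nat.cast_lt, Nat.lt_succ_iff, exists_prop, and_assoc]

theorem one_mem_wordBall (n : ℕ) : (1 : G) ∈ wordBall A n :=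
  mem_wordBall_iff.2 ⟨[], by simp⟩

theorem mul_mem_wordBall {m n : ℕ} {g h : G} (hg : g ∈ wordBall A m) (hh : h ∈ wordBall A n) :
    g * h ∈ wordBall A (m + n) := by
  rw [mem_wordBall_iff] at *
  obtain ⟨v, hv, rfl, hvl⟩ := hg
  obtain ⟨w, hw, rfl, hwl⟩ := hh
  refine ⟨v ++ w, fun x hx => ?_, List.prod_append, by rw [List.length_append]; omega⟩
  rcases List.mem_append.1 hx with hx | hx
  · exact hv x hx
  · exact hw x hx

theorem wordBall_add (m n : ℕ) :
    wordBall A (m + n) = (fun p : G × G => p.1 * p.2) '' (wordBall A m ×ˢ wordBall A n) := by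
  ext g
  constructor
  · intro h
    obtain ⟨w, hw, rfl, hl⟩ := mem_wordBall_iff.1 h
    refine ⟨((w.take m).prod, (w.drop m).prod), ⟨?_, ?_⟩, List.prod_take_mul_prod_drop w m⟩
    · exact mem_wordBall_iff.2 ⟨_, fun x hx => hw x (List.mem_of_mem_take hx), rfl,
        List.length_take_le _ _⟩
    · exact mem_wordBall_iff.2 ⟨_, fun x hx => hw x (List.mem_of_mem_drop hx), rfl,
        by rw [List.length_drop]; omega⟩
  · rintro ⟨⟨a, b⟩, ⟨ha, hb⟩, rfl⟩
    exact mul_mem_wordBall ha hb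

theorem finite_wordBall (hA : A.Finite) (n : ℕ) : (wordBall A n).Finite := by
  have h0 : (wordBall A 0).Finite := by
    refine (Set.finite_singleton (1 : G)).subset fun g hg => ?_
    obtain ⟨w, -, rfl, hl⟩ := mem_wordBall_iff.1 hg
    rw [List.length_eq_zero_iff.1 (Nat.le_zero.1 hl)]
    rfl
  induction n with
  | zero => exact h0
  | succ n ih =>
    have h1 : (wordBall A 1).Finite := by
      refine ((h0.union hA).union hA.inv).subset fun g hg => ?_
      obtain ⟨w, hw, rfl, hl⟩ := mem_wordBall_iff.1 hg
      match w, hl, hw with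
      | [], _, _ => exact Or.inl (Or.inl (one_mem_wordBall 0))
      | [x], _, hw =>
        rcases hw x (by simp) with h | h
        · exact Or.inl (Or.inr (by simpa using h))
        · exact Or.inr (by simpa using h)
    rw [wordBall_add]
    exact (ih.prod h1).image _

theorem ncard_wordBall_pos (hA : A.Finite) (n : ℕ) : 0 < (wordBall A n).ncard :=
  (Set.ncard_pos (finite_wordBall hA n)).2 ⟨1, one_mem_wordBall n⟩

theorem ncard_wordBall_add_le (hA : A.Finite) (m n : ℕ) :
    (wordBall A (m + n)).ncard ≤ (wordBall A m).ncard * (wordBall A n).ncard := by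
  rw [wordBall_add, ← Set.ncard_prod]
  exact Set.ncard_image_le ((finite_wordBall hA m).prod (finite_wordBall hA n))

/-- The growth rate exists (Fekete's lemma), and exponential lower bounds along multiples of `L`
bound it from below. -/
theorem exists_hasGrowthRate_ge (hA : A.Finite) {r : ℝ} (hr : 0 < r) {L : ℕ} (hL : 0 < L)
    (h : ∀ k : ℕ, (r ^ L) ^ k ≤ (wordBall A (k * L)).ncard) :
    ∃ ω : ℝ, HasGrowthRate A ω ∧ r ≤ ω := by
  let u : ℕ → ℝ := fun n => Real.log (wordBall A n).ncard
  have hpos : ∀ n, (0 : ℝ) < (wordBall A n).ncard := fun n => by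
    exact_mod_cast ncard_wordBall_pos hA n
  have hu0 : ∀ n, 0 ≤ u n := fun n =>
    Real.log_nonneg (by exact_mod_cast ncard_wordBall_pos hA n)
  have hu : Subadditive u := by
    intro m n
    rw [← Real.log_mul (hpos m).ne' (hpos n).ne']
    exact Real.log_le_log (hpos _) (by exact_mod_cast ncard_wordBall_add_le hA m n)
  have hlim := hu.tendsto_lim ⟨0, by
    rintro _ ⟨n, rfl⟩
    exact div_nonneg (hu0 n) n.cast_nonneg⟩
  refine ⟨Real.exp hu.lim, ?_, ?_⟩
  · refine ((Real.continuous_exp.tendsto _).comp hlim).congr fun n => ?_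
    simp only [Function.comp, u]
    rw [Real.rpow_def_of_pos (hpos n), mul_one_div]
  · rw [← Real.exp_log hr]
    refine Real.exp_le_exp.2 ?_
    have hL' : (0 : ℝ) < L := by exact_mod_cast hL
    have hsub : Tendsto (fun k : ℕ => (k + 1) * L) atTop atTop :=
      tendsto_atTop_mono (fun k => Nat.le_mul_of_pos_right _ hL |>.trans' (Nat.le_succ k)) tendsto_id
    refine ge_of_tendsto' (hlim.comp hsub) fun k => ?_
    have hk : (0 : ℝ) < ((k + 1) * L : ℕ) := by exact_mod_cast Nat.mul_pos (Nat.succ_pos k) hL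
    simp only [Function.comp]
    rw [le_div_iff₀ hk, mul_comm, ← Real.log_pow]
    refine Real.log_le_log (by positivity) ?_
    rw [mul_comm (k + 1) L, pow_mul, mul_comm L]
    exact h (k + 1)

end Growth

/-! ### Flows on the Cayley graph of `F ⧸ N` separate products of stems. -/

section Separation

namespace FreeGroup

variable {α : Type*} [DecidableEq α]

/-- The exponent sum of the generator `a`. -/
def exponentSum (a : α) : FreeGroup α →* Multiplicative ℤ :=
  FreeGroup.lift fun i => if i = a then Multiplicative.ofAdd 1 else 1

variable (a : α) (N : Subgroup (FreeGroup α)) [N.Normal]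

/-- The map to a wreath product which records, for a path in the Cayley graph of `F ⧸ N`, its flow
through the edges labelled by `a` and its endpoint. -/
noncomputable def flowHom : FreeGroup α →* Multiplicative ℤ ≀ᵣ (FreeGroup α ⧸ N) :=
  open Classical in
  FreeGroup.lift fun i =>
    ⟨if i = a then Pi.mulSingle 1 (Multiplicative.ofAdd 1) else 1, (of i : FreeGroup α ⧸ N)⟩

theorem flowHom_right (g : FreeGroup α) : (flowHom a N g).right = g := by
  have : RegularWreathProduct.rightHom.comp (flowHom a N) = QuotientGroup.mk' N := by
    ext i
    simp [flowHom]
  exact DFunLike.congr_fun this g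

open scoped commutatorElement in
-- Elements of `N` trace closed paths, so they land in the base of the wreath product, which is
-- abelian. This is the easy half of the Magnus embedding.
theorem commutator_le_ker_flowHom : ⁅N, N⁆ ≤ (flowHom a N).ker := by
  rw [Subgroup.commutator_le]
  intro g hg h hh
  rw [MonoidHom.mem_ker, map_commutatorElement, commutatorElement_eq_one_iff_mul_comm]
  have hg' : (flowHom a N g).right = 1 := by
    rw [flowHom_right, QuotientGroup.eq_one_iff]
    exact hg
  have hh' : (flowHom a N h).right = 1 := by
    rw [flowHom_right, QuotientGroup.eq_one_iff]
    exact hh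
  refine RegularWreathProduct.ext ?_ ?_
  · ext q
    simp [hg', hh', mul_comm]
  · simp [hg', hh']

/-- The flow of `g` through the edges labelled by `a` of the Cayley graph of `F ⧸ N`. -/
noncomputable def flow (g : FreeGroup α) (q : FreeGroup α ⧸ N) : ℤ :=
  Multiplicative.toAdd ((flowHom a N g).left q)

/-- The path of `g * h` is the path of `g` followed by the `g`-translate of the path of `h`. -/
theorem flow_mul (g h : FreeGroup α) (q : FreeGroup α ⧸ N) :
    flow a N (g * h) q = flow a N g q + flow a N h ((g : FreeGroup α ⧸ N)⁻¹ * q) := by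
  simp [flow, flowHom_right]

theorem flow_one (q : FreeGroup α ⧸ N) : flow a N 1 q = 0 := by simp [flow]

open Classical in
theorem flow_of (i : α) (q : FreeGroup α ⧸ N) :
    flow a N (of i) q = if i = a ∧ q = 1 then 1 else 0 := by
  by_cases hi : i = a <;> by_cases hq : q = 1 <;> simp [flow, flowHom, hi, hq]

theorem flow_inv (g : FreeGroup α) (q : FreeGroup α ⧸ N) :
    flow a N g⁻¹ q = -flow a N g (g * q) := by
  simp [flow, flowHom_right]

variable {a N} (hN : N ≤ (exponentSum a).ker)

/-- The height function on the Cayley graph of `F ⧸ N` given by the exponent sum of `a`. -/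
def height (q : FreeGroup α ⧸ N) : ℤ :=
  Multiplicative.toAdd (QuotientGroup.lift N (exponentSum a) hN q)

theorem height_mul (p q : FreeGroup α ⧸ N) : height hN (p * q) = height hN p + height hN q := by
  simp [height]

theorem height_inv (p : FreeGroup α ⧸ N) : height hN p⁻¹ = -height hN p := by
  simp [height]

theorem height_one : height hN (1 : FreeGroup α ⧸ N) = 0 := by simp [height]

theorem height_of_self : height hN (of a : FreeGroup α ⧸ N) = 1 := by
  simp [height, exponentSum]

theorem height_mk (g : FreeGroup α) :
    height hN (g : FreeGroup α ⧸ N) = Multiplicative.toAdd (exponentSum a g) := rfl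

/-- The `a`-flow of `g` is supported on edges whose initial vertex has height in `s`. -/
def FlowIn (s : Set ℤ) (g : FreeGroup α) : Prop :=
  ∀ q, flow a N g q ≠ 0 → height hN q ∈ s

variable {hN}

theorem FlowIn.mono {s t : Set ℤ} {g : FreeGroup α} (h : FlowIn hN s g) (hst : s ⊆ t) :
    FlowIn hN t g := fun q hq => hst (h q hq)

theorem FlowIn.mul {s t : Set ℤ} {g h : FreeGroup α} (hg : FlowIn hN s g) (hh : FlowIn hN t h)
    (hst : ∀ z ∈ t, height hN (g : FreeGroup α ⧸ N) + z ∈ s) : FlowIn hN s (g * h) := by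
  intro q hq
  rw [flow_mul] at hq
  by_cases h1 : flow a N g q = 0
  · rw [h1, zero_add] at hq
    have := hst _ (hh _ hq)
    rwa [← height_mul, mul_inv_cancel_left] at this
  · exact hg q h1

theorem FlowIn.one (s : Set ℤ) : FlowIn hN s 1 := fun q hq => (hq (flow_one a N q)).elim

theorem flowIn_of (i : α) : FlowIn hN {0} (of i) := by
  classical
  intro q hq
  rw [flow_of] at hq
  split_ifs at hq with h
  · rw [h.2, height_one]
    rfl
  · exact (hq rfl).elim

theorem abs_height_of_le (i : α) : |height hN (of i : FreeGroup α ⧸ N)| ≤ 1 := by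
  rw [height_mk]
  by_cases h : i = a <;> simp [exponentSum, h]

theorem flowIn_letter (p : α × Bool) : FlowIn hN (Set.Icc (-1) 1) (mk [p]) ∧
    |height hN (mk [p] : FreeGroup α ⧸ N)| ≤ 1 := by
  obtain ⟨i, b⟩ := p
  cases b
  · have : (mk [(i, false)] : FreeGroup α) = (of i)⁻¹ := by simp [of, inv_mk, invRev]
    rw [this, QuotientGroup.mk_inv, height_inv, abs_neg]
    refine ⟨fun q hq => ?_, abs_height_of_le i⟩
    rw [flow_inv, neg_ne_zero] at hq
    have h1 : height hN ((of i : FreeGroup α ⧸ N) * q) = 0 := flowIn_of i _ hq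
    rw [height_mul] at h1
    have h2 := abs_le.1 (abs_height_of_le (hN := hN) i)
    exact ⟨by linarith, by linarith⟩
  · exact ⟨(flowIn_of i).mono (by simp), abs_height_of_le i⟩

theorem flowIn_mk (w : List (α × Bool)) : FlowIn hN (Set.Icc (-w.length) w.length) (mk w) ∧
    |height hN (mk w : FreeGroup α ⧸ N)| ≤ w.length := by
  induction w with
  | nil =>
    rw [← one_eq_mk, QuotientGroup.mk_one, height_one]
    exact ⟨FlowIn.one _, by simp⟩
  | cons p w ih =>
    have h : (mk (p :: w) : FreeGroup α) = mk [p] * mk w := by rw [mul_mk]; rfl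
    have hp := flowIn_letter (hN := hN) p
    rw [h, QuotientGroup.mk_mul, height_mul, List.length_cons, Nat.cast_succ]
    have h1 := abs_le.1 hp.2
    refine ⟨(hp.1.mono ?_).mul ih.1 ?_, (abs_add_le _ _).trans (by linarith [hp.2, ih.2])⟩
    · exact Set.Icc_subset_Icc (by omega) (by omega)
    · rintro z ⟨hz, hz'⟩
      exact ⟨by linarith, by linarith⟩

theorem flowIn_of_norm_le {g : FreeGroup α} {b : ℕ} (h : g.norm ≤ b) :
    FlowIn hN (Set.Icc (-b) b) g := by
  have := (flowIn_mk (hN := hN) g.toWord).1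
  rw [mk_toWord] at this
  have h' : (g.toWord.length : ℤ) ≤ b := by exact_mod_cast h
  exact this.mono (Set.Icc_subset_Icc (by omega) h')

theorem height_of_self_pow (k : ℕ) : height hN ((of a ^ k : FreeGroup α) : FreeGroup α ⧸ N) = k := by
  induction k with
  | zero => rw [pow_zero, QuotientGroup.mk_one, height_one]; rfl
  | succ k ih => rw [pow_succ, QuotientGroup.mk_mul, height_mul, ih, height_of_self]; simp

theorem flowIn_of_self_pow (k : ℕ) : FlowIn hN (Set.Ico 0 k) (of a ^ k) := by
  induction k with
  | zero => exact FlowIn.one _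
  | succ k ih =>
    rw [pow_succ]
    refine (ih.mono (Set.Ico_subset_Ico le_rfl (by simp))).mul (flowIn_of a) ?_
    rintro z rfl
    rw [height_of_self_pow]
    simp

theorem height_list_prod {c : ℤ} (l : List (FreeGroup α))
    (h : ∀ g ∈ l, height hN (g : FreeGroup α ⧸ N) = c) :
    height hN ((l.prod : FreeGroup α) : FreeGroup α ⧸ N) = l.length * c := by
  induction l with
  | nil => simp [height_one]
  | cons g l ih =>
    rw [List.prod_cons, QuotientGroup.mk_mul, height_mul, h g (by simp),
      ih fun x hx => h x (by simp [hx])]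
    push_cast [List.length_cons]
    ring

/-- As `c ≥ 0`, every factor starts at a height between `0` and `l.length * c`, and strays from it
by at most `b`. -/
theorem flowIn_list_prod {c : ℤ} (hc : 0 ≤ c) {b : ℕ} (l : List (FreeGroup α))
    (h : ∀ g ∈ l, height hN (g : FreeGroup α ⧸ N) = c) (hb : ∀ g ∈ l, g.norm ≤ b) :
    FlowIn hN (Set.Icc (-b) (l.length * c + b)) l.prod := by
  induction l with
  | nil => exact FlowIn.one _
  | cons g l ih =>
    rw [List.prod_cons, List.length_cons]
    have hlc : 0 ≤ (l.length : ℤ) * c := by positivity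
    push_cast
    refine ((flowIn_of_norm_le (hb g (by simp))).mono ?_).mul
      (ih (fun x hx => h x (by simp [hx])) fun x hx => hb x (by simp [hx])) ?_
    · exact Set.Icc_subset_Icc le_rfl (by linarith)
    · rintro z ⟨hz, hz'⟩
      rw [h g (by simp)]
      exact ⟨by linarith, by linarith⟩

/-- `g` leads from height `0` to height `D`, and all its `a`-edges start at heights in `[0, D)`. -/
def IsStem (hN : N ≤ (exponentSum a).ker) (D : ℤ) (g : FreeGroup α) : Prop :=
  FlowIn hN (Set.Ico 0 D) g ∧ height hN (g : FreeGroup α ⧸ N) = D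

/-- The prefix `a^b` lifts the middle part so that its `a`-edges start in `[0, 2b + l.length * c]`;
the suffix `a^(b+1)` then ends strictly above that interval. -/
theorem isStem_conj {c : ℤ} (hc : 0 ≤ c) {b : ℕ} (l : List (FreeGroup α))
    (h : ∀ g ∈ l, height hN (g : FreeGroup α ⧸ N) = c) (hb : ∀ g ∈ l, g.norm ≤ b) :
    IsStem hN (2 * b + 1 + l.length * c) (of a ^ b * l.prod * of a ^ (b + 1)) := by
  have hlc : 0 ≤ (l.length : ℤ) * c := by positivity
  have h1 : height hN ((of a ^ b * l.prod : FreeGroup α) : FreeGroup α ⧸ N)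
      = b + l.length * c := by
    rw [QuotientGroup.mk_mul, height_mul, height_of_self_pow, height_list_prod l h]
  constructor
  · refine FlowIn.mul (FlowIn.mul ((flowIn_of_self_pow b).mono ?_) (flowIn_list_prod hc l h hb) ?_)
      (flowIn_of_self_pow (b + 1)) ?_
    · exact Set.Ico_subset_Ico le_rfl (by linarith)
    · rintro z ⟨hz, hz'⟩
      rw [height_of_self_pow]
      exact ⟨by linarith, by linarith⟩
    · rintro z ⟨hz, hz'⟩
      rw [h1]
      push_cast at hz'
      exact ⟨by linarith, by linarith⟩
  · rw [QuotientGroup.mk_mul, height_mul, h1, height_of_self_pow]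
    push_cast
    ring

theorem IsStem.flowIn_prod {D : ℤ} (hD : 0 ≤ D) (l : List (FreeGroup α))
    (h : ∀ g ∈ l, IsStem hN D g) : FlowIn hN (Set.Ici 0) (l.map fun g => g * of a).prod := by
  induction l with
  | nil => exact FlowIn.one _
  | cons g l ih =>
    rw [List.map_cons, List.prod_cons]
    have hg := h g (by simp)
    refine FlowIn.mul (FlowIn.mul (hg.1.mono fun z hz => hz.1) (flowIn_of a) ?_)
      (ih fun x hx => h x (by simp [hx])) ?_
    · rintro z rfl
      rw [hg.2, add_zero]
      exact hD
    · intro z hz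
      rw [Set.mem_Ici] at hz ⊢
      rw [QuotientGroup.mk_mul, height_mul, hg.2, height_of_self]
      linarith

open Classical in
-- The edges of `g` start below `D`, and everything after the separating `a` stays at heights at
-- least `D + 1`.
theorem IsStem.flow_top {D : ℤ} (hD : 0 ≤ D) {g : FreeGroup α} (hg : IsStem hN D g)
    (l : List (FreeGroup α)) (h : ∀ g ∈ l, IsStem hN D g) {q : FreeGroup α ⧸ N}
    (hq : height hN q = D) :
    flow a N (g * of a * (l.map fun g => g * of a).prod) q = if q = g then 1 else 0 := by
  have h1 : flow a N g q = 0 := by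
    by_contra hne
    have := (hg.1 q hne).2
    omega
  have h2 : flow a N (l.map fun g => g * of a).prod
      (((g * of a : FreeGroup α) : FreeGroup α ⧸ N)⁻¹ * q) = 0 := by
    by_contra hne
    have := IsStem.flowIn_prod hD l h _ hne
    rw [Set.mem_Ici, height_mul, height_inv, QuotientGroup.mk_mul, height_mul, hg.2, hq,
      height_of_self] at this
    omega
  rw [flow_mul, flow_mul, h1, h2, flow_of, zero_add, add_zero]
  simp only [true_and, inv_mul_eq_one, @eq_comm _ q]

/-- Products of stems are determined by their image in the wreath product. -/
theorem eq_of_flowHom_prod_eq {D : ℤ} (hD : 0 ≤ D) {S : Set (FreeGroup α)}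
    (hS : ∀ g ∈ S, IsStem hN D g)
    (hinj : Set.InjOn (fun g : FreeGroup α => (g : FreeGroup α ⧸ N)) S) :
    ∀ (l l' : List (FreeGroup α)), l.length = l'.length → (∀ g ∈ l, g ∈ S) → (∀ g ∈ l', g ∈ S) →
      flowHom a N (l.map fun g => g * of a).prod = flowHom a N (l'.map fun g => g * of a).prod →
      l = l'
  | [], [], _, _, _, _ => rfl
  | g :: l, g' :: l', hlen, hl, hl', h => by
    classical
    have hg := hl g (by simp)
    have hg' := hl' g' (by simp)
    have hl2 : ∀ x ∈ l, x ∈ S := fun x hx => hl x (by simp [hx])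
    have hl2' : ∀ x ∈ l', x ∈ S := fun x hx => hl' x (by simp [hx])
    simp only [List.map_cons, List.prod_cons] at h
    have hflow : flow a N (g * of a * (l.map fun g => g * of a).prod) g
        = flow a N (g' * of a * (l'.map fun g => g * of a).prod) g := by
      unfold flow
      rw [h]
    rw [IsStem.flow_top hD (hS g hg) l (fun x hx => hS x (hl2 x hx)) (hS g hg).2,
      IsStem.flow_top hD (hS g' hg') l' (fun x hx => hS x (hl2' x hx)) (hS g hg).2,
      if_pos rfl] at hflow
    have hgg : (g : FreeGroup α ⧸ N) = g' := by
      by_contra hne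
      rw [if_neg hne] at hflow
      exact one_ne_zero hflow
    obtain rfl : g = g' := hinj hg hg' hgg
    rw [_root_.map_mul _ (g * of a) (l.map _).prod, _root_.map_mul _ (g * of a) (l'.map _).prod,
      mul_left_cancel_iff] at h
    rw [eq_of_flowHom_prod_eq hD hS hinj l l' (by simpa using hlen) hl2 hl2' h]

end FreeGroup

end Separation

/-! ### Exponentially many elements in the balls of `F_m / γ_n(F_m)'`. -/

section FreeAbByNil

open FreeGroup

theorem freeGamma_le_commutator {m n : ℕ} (hn : 2 ≤ n) :
    freeGamma m n ≤ commutator (FreeGroup (Fin m)) := by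
  rw [← Subgroup.top_lowerCentralSeries_one]
  exact Subgroup.lowerCentralSeries_antitone _ (by omega)

theorem freeGamma_le_ker {m n : ℕ} (hn : 2 ≤ n) {A : Type*} [CommGroup A]
    (f : FreeGroup (Fin m) →* A) : freeGamma m n ≤ f.ker :=
  (freeGamma_le_commutator hn).trans (Abelianization.commutator_subset_ker f)

theorem FreeGroup.norm_list_prod_le {α : Type*} [DecidableEq α] {L : ℕ} (l : List (FreeGroup α))
    (h : ∀ g ∈ l, g.norm ≤ L) : l.prod.norm ≤ l.length * L := by
  induction l with
  | nil => simp
  | cons g l ih =>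
    rw [List.prod_cons, List.length_cons, Nat.succ_mul, add_comm]
    exact (norm_mul_le _ _).trans (add_le_add (h g (by simp)) (ih fun x hx => h x (by simp [hx])))

theorem mk_mem_wordBall {m n L : ℕ} {g : FreeGroup (Fin m)} (h : g.norm ≤ L) :
    (g : FreeAbByNil m n) ∈ wordBall (freeAbByNilGens m n) L := by
  let f : Fin m → FreeAbByNil m n := fun i => (FreeGroup.of i : FreeGroup (Fin m))
  have hlift : QuotientGroup.mk' _ = FreeGroup.lift f := by
    ext i
    simp [f]
  refine mem_wordBall_iff.2 ⟨g.toWord.map fun x => cond x.2 (f x.1) (f x.1)⁻¹, ?_, ?_, ?_⟩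
  · intro x hx
    obtain ⟨⟨i, b⟩, -, rfl⟩ := List.mem_map.1 hx
    cases b
    · exact Or.inr ⟨i, by simp [f]⟩
    · exact Or.inl ⟨i, rfl⟩
  · rw [← FreeGroup.lift_mk, mk_toWord, ← hlift]
    rfl
  · rw [List.length_map]
    exact h

theorem finite_freeAbByNilGens (m n : ℕ) : (freeAbByNilGens m n).Finite := Set.finite_range _

/-- It matters that `n` does not depend on `k`: only the finitely many stems have to be separated
modulo `γ_n`, not their products. The length of a block is `b + s b + (b + 1) + 1 = (s + 2) b + 2`.
-/
theorem exists_pow_le_ncard_wordBall {m : ℕ} (a : Fin m) (V : Finset (FreeGroup (Fin m))) {b : ℕ}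
    (s : ℕ) {c : ℤ} (hc : 0 ≤ c) (hb : ∀ v ∈ V, v.norm ≤ b)
    (hV : ∀ v ∈ V, Multiplicative.toAdd (exponentSum a v) = c)
    (hinj : ∀ l l' : List (FreeGroup (Fin m)), l.length = l'.length → (∀ v ∈ l, v ∈ V) →
      (∀ v ∈ l', v ∈ V) → l.prod = l'.prod → l = l') :
    ∃ n, 2 ≤ n ∧ ∀ k, (V.card ^ s) ^ k ≤
      (wordBall (freeAbByNilGens m n) (k * ((s + 2) * b + 2))).ncard := by
  classical
  let stem : (Fin s → V) → FreeGroup (Fin m) := fun f =>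
    of a ^ b * (List.ofFn fun i => (f i : FreeGroup (Fin m))).prod * of a ^ (b + 1)
  have hmem : ∀ f : Fin s → V, ∀ v ∈ List.ofFn fun i => (f i : FreeGroup (Fin m)), v ∈ V := by
    intro f v hv
    obtain ⟨i, rfl⟩ := (List.mem_ofFn' _ _).1 hv
    exact (f i).2
  have hstem : Function.Injective stem := by
    intro f f' h
    have h1 := mul_left_cancel (mul_right_cancel h)
    have h2 := List.ofFn_injective (hinj _ _ (by simp) (hmem f) (hmem f') h1)
    exact funext fun i => Subtype.ext (congrFun h2 i)
  let S : Finset (FreeGroup (Fin m)) := Finset.univ.image stem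
  obtain ⟨n₀, hn₀⟩ := exists_lowerCentralSeries_disjoint_finset
    ((S ×ˢ S).image fun p => p.1⁻¹ * p.2)
  -- With `n ≥ 2`, `γ_n` lies in the commutator subgroup, so heights are defined on the quotient.
  refine ⟨n₀ + 2, by omega, fun k => ?_⟩
  set n := n₀ + 2 with hn
  have hN : freeGamma m n ≤ (exponentSum a).ker := freeGamma_le_ker (by omega) _
  have hSinj : Set.InjOn
      (fun g : FreeGroup (Fin m) => (g : FreeGroup (Fin m) ⧸ freeGamma m n)) S := by
    intro g hg g' hg' h
    exact inv_mul_eq_one.1 (hn₀ (n - 1) (by omega) _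
      (Finset.mem_image.2 ⟨(g, g'), Finset.mem_product.2 ⟨hg, hg'⟩, rfl⟩) (QuotientGroup.eq.1 h))
  have hSstem : ∀ g ∈ (S : Set (FreeGroup (Fin m))), IsStem hN (2 * b + 1 + s * c) g := by
    intro g hg
    obtain ⟨f, -, rfl⟩ := Finset.mem_image.1 hg
    have := isStem_conj (hN := hN) hc (b := b) (List.ofFn fun i => (f i : FreeGroup (Fin m)))
      (fun v hv => hV v (hmem f v hv)) fun v hv => hb v (hmem f v hv)
    rwa [List.length_ofFn] at this
  have hnorm : ∀ f, (stem f * of a).norm ≤ (s + 2) * b + 2 := by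
    intro f
    have h1 := norm_list_prod_le (List.ofFn fun i => (f i : FreeGroup (Fin m)))
      fun v hv => hb v (hmem f v hv)
    rw [List.length_ofFn] at h1
    refine (FreeGroup.norm_mul_le _ _).trans ((add_le_add ((FreeGroup.norm_mul_le _ _).trans
      (add_le_add ((FreeGroup.norm_mul_le _ _).trans (add_le_add le_rfl h1)) le_rfl)) le_rfl).trans ?_)
    rw [norm_of_pow, norm_of_pow, norm_of]
    linarith
  let Φ : (Fin k → Fin s → V) → FreeAbByNil m n := fun f =>
    ((((List.ofFn fun j => stem (f j)).map fun g => g * of a).prod : FreeGroup (Fin m)) :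
      FreeAbByNil m n)
  have hstemS : ∀ f : Fin k → Fin s → V, ∀ g ∈ List.ofFn fun j => stem (f j),
      g ∈ (S : Set (FreeGroup (Fin m))) := by
    intro f g hg
    obtain ⟨j, rfl⟩ := (List.mem_ofFn' _ _).1 hg
    exact Finset.mem_coe.2 (Finset.mem_image_of_mem _ (Finset.mem_univ _))
  have hΦ : Function.Injective Φ := by
    intro f f' h
    have h1 := commutator_le_ker_flowHom a (freeGamma m n) (QuotientGroup.eq.1 h)
    rw [MonoidHom.mem_ker, _root_.map_mul, _root_.map_inv, inv_mul_eq_one] at h1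
    have h2 := List.ofFn_injective (eq_of_flowHom_prod_eq (by positivity) hSstem hSinj _ _
      (by simp) (hstemS f) (hstemS f') h1)
    exact funext fun j => hstem (congrFun h2 j)
  have hball : Set.range Φ ⊆ wordBall (freeAbByNilGens m n) (k * ((s + 2) * b + 2)) := by
    rintro _ ⟨f, rfl⟩
    have := norm_list_prod_le (L := (s + 2) * b + 2)
      ((List.ofFn fun j => stem (f j)).map fun g => g * of a) (by
        intro g hg
        obtain ⟨x, hx, rfl⟩ := List.mem_map.1 hg
        obtain ⟨j, rfl⟩ := (List.mem_ofFn' _ _).1 hx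
        exact hnorm _)
    rw [List.length_map, List.length_ofFn] at this
    exact mk_mem_wordBall this
  calc (V.card ^ s) ^ k = Nat.card (Fin k → Fin s → V) := by simp
    _ = (Set.range Φ).ncard := by
      rw [← Set.image_univ, Set.ncard_image_of_injective _ hΦ, Set.ncard_univ]
    _ ≤ _ := Set.ncard_le_ncard hball (finite_wordBall (finite_freeAbByNilGens m n) _)

end FreeAbByNil

/-! ### Large sets of words generating free semigroups. -/

section Words

section ProdInjective

variable {G : Type*} [Group G]

/-- Products of equally many elements of `V` determine their factors. -/
def ProdInjective (V : Set (G)) : Prop :=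
  ∀ l l' : List (G), l.length = l'.length → (∀ v ∈ l, v ∈ V) → (∀ v ∈ l', v ∈ V) →
    l.prod = l'.prod → l = l'

theorem ProdInjective.mono {V W : Set (G)} (hW : ProdInjective W) (h : V ⊆ W) :
    ProdInjective V :=
  fun l l' hll hl hl' => hW l l' hll (fun v hv => h (hl v hv)) fun v hv => h (hl' v hv)

theorem ProdInjective.inv {V W : Set (G)} (hV : ProdInjective V)
    (h : ∀ w ∈ W, w⁻¹ ∈ V) : ProdInjective W := by
  intro l l' hll hl hl' heq
  have h1 := congrArg (·⁻¹) heq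
  simp only [List.prod_inv_reverse] at h1
  have hmem : ∀ l : List (G), (∀ v ∈ l, v ∈ W) →
      ∀ v ∈ (l.map (·⁻¹)).reverse, v ∈ V := by
    intro l hl v hv
    rw [List.mem_reverse] at hv
    obtain ⟨w, hw, rfl⟩ := List.mem_map.1 hv
    exact h w (hl w hw)
  have h2 := hV _ _ (by simpa using hll) (hmem l hl) (hmem l' hl') h1
  exact List.map_injective_iff.2 inv_injective (List.reverse_injective h2)

theorem prodInjective_singleton (g : G) : ProdInjective {g} := by
  intro l l' hll hl hl' _
  rw [List.eq_replicate_iff.2 ⟨rfl, hl⟩, List.eq_replicate_iff.2 ⟨rfl, hl'⟩, hll]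

end ProdInjective

namespace FreeGroup

variable {α : Type*} [DecidableEq α]

/-- No factor ends with the inverse of the common first letter `p`, so nothing cancels at the seams.
-/
theorem toWord_list_prod {p : α × Bool} (l : List (FreeGroup α))
    (hhead : ∀ v ∈ l, v.toWord.head? = some p)
    (hlast : ∀ v ∈ l, ∀ z ∈ v.toWord.getLast?, z.1 = p.1 → z.2 = p.2) :
    l.prod.toWord = (l.map toWord).flatten := by
  have hmk : ∀ l : List (FreeGroup α), l.prod = mk (l.map toWord).flatten := by
    intro l
    induction l with
    | nil => rfl
    | cons v l ih =>
      rw [List.prod_cons, ih, List.map_cons, List.flatten_cons, ← mul_mk, mk_toWord]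
  rw [hmk, toWord_mk]
  refine IsReduced.reduce_eq ((List.isChain_flatten ?_).2 ⟨?_, ?_⟩)
  · intro h
    obtain ⟨v, hv, h0⟩ := List.mem_map.1 h
    have := hhead v hv
    rw [h0] at this
    simp at this
  · intro w hw
    obtain ⟨v, -, rfl⟩ := List.mem_map.1 hw
    exact isReduced_toWord
  · refine List.Pairwise.isChain (List.pairwise_of_forall_mem_list ?_)
    intro w hw w' hw' x hx y hy
    obtain ⟨v, hv, rfl⟩ := List.mem_map.1 hw
    obtain ⟨v', hv', rfl⟩ := List.mem_map.1 hw'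
    rw [hhead v' hv', Option.mem_some_iff] at hy
    subst hy
    exact hlast v hv x hx

/-- Words of one fixed length can be read off from their concatenation. -/
theorem prodInjective_of_toWord {p : α × Bool} {b : ℕ} {V : Set (FreeGroup α)}
    (hlen : ∀ v ∈ V, v.toWord.length = b) (hhead : ∀ v ∈ V, v.toWord.head? = some p)
    (hlast : ∀ v ∈ V, ∀ z ∈ v.toWord.getLast?, z.1 = p.1 → z.2 = p.2) : ProdInjective V := by
  intro l l' hll hl hl' h
  have hw := congrArg toWord h
  rw [toWord_list_prod l (fun v hv => hhead v (hl v hv)) fun v hv => hlast v (hl v hv),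
    toWord_list_prod l' (fun v hv => hhead v (hl' v hv)) fun v hv => hlast v (hl' v hv)] at hw
  refine List.map_injective_iff.2 toWord_injective (List.eq_iff_flatten_eq.2 ⟨hw, ?_⟩)
  have hrep : ∀ l : List (FreeGroup α), (∀ v ∈ l, v ∈ V) →
      (l.map toWord).map List.length = List.replicate l.length b := by
    intro l hl
    rw [List.eq_replicate_iff]
    refine ⟨by simp, fun x hx => ?_⟩
    rw [List.map_map] at hx
    obtain ⟨v, hv, rfl⟩ := List.mem_map.1 hx
    exact hlen v (hl v hv)
  rw [hrep l hl, hrep l' hl', hll]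

/-- There are `(2m-1)^k` ways to extend a letter by `k` letters to a reduced word. -/
theorem exists_finset_isReduced_cons [Fintype α] (k : ℕ) (p : α × Bool) :
    ∃ T : Finset (List (α × Bool)), T.card = (2 * Fintype.card α - 1) ^ k ∧
      ∀ u ∈ T, u.length = k ∧ IsReduced (p :: u) := by
  induction k generalizing p with
  | zero => exact ⟨{[]}, by simp, by simp⟩
  | succ k ih =>
    choose T hcard hT using ih
    refine ⟨(Finset.univ.erase (p.1, !p.2)).biUnion fun q => (T q).image (List.cons q), ?_, ?_⟩
    · rw [Finset.card_biUnion]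
      · simp only [Finset.card_image_of_injective _ List.cons_injective, hcard]
        rw [Finset.sum_const, Finset.card_erase_of_mem (Finset.mem_univ _), Finset.card_univ,
          Fintype.card_prod, Fintype.card_bool, smul_eq_mul, pow_succ', mul_comm (Fintype.card α)]
      · intro q _ q' _ hne
        refine Finset.disjoint_left.2 fun u hu hu' => ?_
        obtain ⟨v, -, rfl⟩ := Finset.mem_image.1 hu
        obtain ⟨v', -, h⟩ := Finset.mem_image.1 hu'
        exact hne (List.cons_eq_cons.1 h).1.symm
    · intro u hu
      obtain ⟨q, hq, hu⟩ := Finset.mem_biUnion.1 hu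
      obtain ⟨v, hv, rfl⟩ := Finset.mem_image.1 hu
      refine ⟨by rw [List.length_cons, (hT q v hv).1], ?_⟩
      refine isReduced_cons_cons.2 ⟨fun h1 => ?_, (hT q v hv).2⟩
      by_contra h2
      refine (Finset.mem_erase.1 hq).1 (Prod.ext h1.symm ?_)
      cases hp : p.2 <;> cases hq : q.2 <;> simp_all

/-- The words are `a u z`, with `u` of length `k`. The last letter `z` is `a`, unless this would
cancel against a preceding `a⁻¹`; then it is the second generator `a'`. -/
theorem exists_finset_prodInjective [Fintype α] {a a' : α} (ha : a' ≠ a) (k : ℕ) :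
    ∃ V : Finset (FreeGroup α), V.card = (2 * Fintype.card α - 1) ^ k ∧
      (∀ v ∈ V, v.norm ≤ k + 2) ∧ ProdInjective (V : Set (FreeGroup α)) := by
  obtain ⟨T, hcard, hT⟩ := exists_finset_isReduced_cons k (a, true)
  let z : List (α × Bool) → α × Bool := fun u =>
    if (a, false) ∈ ((a, true) :: u).getLast? then (a', true) else (a, true)
  let w : List (α × Bool) → List (α × Bool) := fun u => (a, true) :: u ++ [z u]
  have hred : ∀ u ∈ T, IsReduced (w u) := by
    intro u hu
    refine List.isChain_append.2 ⟨(hT u hu).2, List.isChain_singleton _, ?_⟩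
    rintro ⟨x, e⟩ hx y hy
    obtain rfl : z u = y := by simpa using hy
    simp only [z]
    split_ifs with h
    · have := Option.mem_unique hx h
      rw [Prod.mk.injEq] at this
      rintro rfl
      exact (ha this.1).elim
    · rintro rfl
      cases e
      · exact (h hx).elim
      · rfl
  have hword : ∀ u ∈ T, (mk (w u)).toWord = w u := fun u hu => by
    rw [toWord_mk, (hred u hu).reduce_eq]
  refine ⟨T.image fun u => mk (w u), ?_, ?_, ?_⟩
  · rw [Finset.card_image_of_injOn, hcard]
    intro u hu u' hu' h
    have h1 : w u = w u' := by
      rw [← hword u hu, ← hword u' hu']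
      exact congrArg toWord h
    have h2 := List.append_inj_left' h1 rfl
    exact (List.cons_eq_cons.1 h2).2
  · intro v hv
    obtain ⟨u, hu, rfl⟩ := Finset.mem_image.1 hv
    refine norm_mk_le.trans ?_
    simp [w, (hT u hu).1]
  · have hmem : ∀ v ∈ (T.image fun u => mk (w u) : Finset (FreeGroup α)), ∃ u ∈ T, v.toWord = w u := by
      intro v hv
      obtain ⟨u, hu, rfl⟩ := Finset.mem_image.1 hv
      exact ⟨u, hu, hword u hu⟩
    refine prodInjective_of_toWord (p := (a, true)) (b := k + 2) ?_ ?_ ?_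
    · intro v hv
      obtain ⟨u, hu, h⟩ := hmem v hv
      simp [h, w, (hT u hu).1]
    · intro v hv
      obtain ⟨u, hu, h⟩ := hmem v hv
      simp [h, w]
    · intro v hv y hy
      obtain ⟨u, hu, h⟩ := hmem v hv
      rw [h, List.getLast?_append_of_ne_nil _ (List.cons_ne_nil _ _), List.getLast?_singleton,
        Option.mem_some_iff] at hy
      subst hy
      simp only [z]
      split_ifs <;> simp

theorem abs_exponentSum_le (a : α) (g : FreeGroup α) :
    |Multiplicative.toAdd (exponentSum a g)| ≤ g.norm := by
  -- On `F ⧸ ⊥` the height is the exponent sum itself.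
  have := (flowIn_mk (N := ⊥) (hN := bot_le (a := (exponentSum a).ker)) g.toWord).2
  rwa [mk_toWord, height_mk] at this

/-- Linear factors do not matter for exponential growth. -/
theorem exists_linear_mul_pow_lt {r t : ℝ} (hr : 0 < r) (h : r < t) :
    ∃ k : ℕ, (2 * k + 5) * r ^ (k + 2) < t ^ k := by
  have ht := hr.trans h
  have hq0 : 0 ≤ r / t := (div_pos hr ht).le
  have hq1 : r / t < 1 := (div_lt_one ht).2 h
  have h1 := tendsto_self_mul_const_pow_of_lt_one hq0 hq1
  have h2 := tendsto_pow_atTop_nhds_zero_of_lt_one hq0 hq1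
  have h3 : Tendsto (fun k : ℕ => (2 * (k * (r / t) ^ k) + 5 * (r / t) ^ k) * r ^ 2) atTop (𝓝 0) := by
    simpa using ((h1.const_mul 2).add (h2.const_mul 5)).mul_const (r ^ 2)
  obtain ⟨k, hk⟩ := (h3.eventually_lt_const one_pos).exists
  refine ⟨k, ?_⟩
  have htk : 0 < t ^ k := pow_pos ht k
  rw [div_pow] at hk
  calc (2 * k + 5) * r ^ (k + 2)
      = (2 * (k * (r ^ k / t ^ k)) + 5 * (r ^ k / t ^ k)) * r ^ 2 * t ^ k := by
        field_simp
        ring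
    _ < 1 * t ^ k := mul_lt_mul_of_pos_right hk htk
    _ = t ^ k := one_mul _

/-- Sets of elements of a common nonnegative exponent sum which generate a free semigroup of nearly
maximal growth. -/
theorem exists_finset_exponentSum_eq {m : ℕ} (a : Fin m) {r : ℝ} (hr : 0 < r)
    (h : r < 2 * m - 1) :
    ∃ (b : ℕ) (c : ℤ) (V : Finset (FreeGroup (Fin m))), 0 ≤ c ∧ r ^ b < V.card ∧
      (∀ v ∈ V, v.norm ≤ b) ∧ (∀ v ∈ V, Multiplicative.toAdd (exponentSum a v) = c) ∧
      ProdInjective (V : Set (FreeGroup (Fin m))) := by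
  -- In rank one no `a'` exists, but then `r < 1` and the single element `a` suffices.
  by_cases hm : m = 1
  · subst hm
    refine ⟨1, 1, {of a}, zero_le_one, ?_, ?_, ?_, ?_⟩
    · norm_num at h ⊢
      exact h
    · simp
    · simp [exponentSum]
    · simpa using prodInjective_singleton (of a)
  have hm2 : 2 ≤ m := by have := a.pos; omega
  obtain ⟨a', ha'⟩ : ∃ a' : Fin m, a' ≠ a := by
    have : Nontrivial (Fin m) := Fin.nontrivial_iff_two_le.2 hm2
    exact exists_ne a
  obtain ⟨k, hk⟩ := exists_linear_mul_pow_lt hr h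
  obtain ⟨V, hcard, hnorm, hV⟩ := exists_finset_prodInjective ha' k
  have hcard' : (V.card : ℝ) = (2 * m - 1) ^ k := by
    rw [hcard, Fintype.card_fin, Nat.cast_pow, Nat.cast_sub (by omega)]
    push_cast
    rfl
  -- Pigeonhole over the `2k + 5` possible exponent sums in `[-(k+2), k+2]`.
  obtain ⟨c, -, hc⟩ := Finset.exists_lt_card_fiber_of_nsmul_lt_card_of_maps_to
    (s := V) (t := Finset.Icc (-(k + 2 : ℤ)) (k + 2))
    (f := fun v => Multiplicative.toAdd (exponentSum a v)) (b := r ^ (k + 2))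
    (fun v hv => by
      have := abs_le.1 ((abs_exponentSum_le a v).trans (Int.ofNat_le.2 (hnorm v hv)))
      push_cast at this
      exact Finset.mem_Icc.2 this)
    (by
      rw [hcard', Int.card_Icc, nsmul_eq_mul]
      have : ((k + 2 + 1 - -(k + 2) : ℤ).toNat : ℝ) = 2 * k + 5 := by
        have : (k + 2 + 1 - -(k + 2) : ℤ).toNat = 2 * k + 5 := by omega
        rw [this]
        push_cast
        rfl
      rwa [this])
  set W := V.filter fun v => Multiplicative.toAdd (exponentSum a v) = c with hWdef
  have hW : ∀ v ∈ W, v ∈ V ∧ Multiplicative.toAdd (exponentSum a v) = c :=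
    fun v hv => Finset.mem_filter.1 hv
  rcases le_total 0 c with h0 | h0
  · exact ⟨k + 2, c, W, h0, hc, fun v hv => hnorm v (hW v hv).1, fun v hv => (hW v hv).2,
      hV.mono fun v hv => (hW v hv).1⟩
  · refine ⟨k + 2, -c, W.image (·⁻¹), by omega, ?_, ?_, ?_, ?_⟩
    · rwa [Finset.card_image_of_injective _ inv_injective]
    · intro v hv
      obtain ⟨w, hw, rfl⟩ := Finset.mem_image.1 hv
      rw [norm_inv_eq]
      exact hnorm w (hW w hw).1
    · intro v hv
      obtain ⟨w, hw, rfl⟩ := Finset.mem_image.1 hv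
      rw [_root_.map_inv, toAdd_inv, (hW w hw).2]
    · refine hV.inv fun v hv => ?_
      obtain ⟨w, hw, rfl⟩ := Finset.mem_image.1 hv
      rw [inv_inv]
      exact (hW w hw).1

end FreeGroup

end Words

/-! ### Structure of `F_m / γ_n(F_m)'` and conclusion. -/

section Main

open FreeGroup

theorem ncard_freeAbByNilGens {m n : ℕ} (hn : 2 ≤ n) : (freeAbByNilGens m n).ncard = m := by
  have hinj : Function.Injective
      fun i : Fin m => (QuotientGroup.mk (FreeGroup.of i) : FreeAbByNil m n) := by
    intro i j h
    have h1 : (of i)⁻¹ * of j ∈ freeGamma m n :=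
      Subgroup.commutator_le_left _ _ (QuotientGroup.eq.1 h)
    have h2 := freeGamma_le_ker hn (exponentSum i) h1
    rw [MonoidHom.mem_ker, _root_.map_mul, _root_.map_inv, inv_mul_eq_one] at h2
    by_contra hne
    simp [exponentSum, Ne.symm hne] at h2
  rw [freeAbByNilGens, ← Set.image_univ, Set.ncard_image_of_injective _ hinj, Set.ncard_univ,
    Nat.card_fin]

theorem closure_freeAbByNilGens (m n : ℕ) : Subgroup.closure (freeAbByNilGens m n) = ⊤ := by
  have : freeAbByNilGens m n = QuotientGroup.mk' _ '' Set.range FreeGroup.of := by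
    rw [← Set.range_comp]
    rfl
  rw [this, ← MonoidHom.map_closure, FreeGroup.closure_range_of,
    Subgroup.map_top_of_surjective _ (QuotientGroup.mk'_surjective _)]

theorem isNilpotent_quotient_lowerCentralSeries {G : Type*} [Group G] (n : ℕ) :
    Group.IsNilpotent (G ⧸ (⊤ : Subgroup G).lowerCentralSeries n) := by
  refine Subgroup.nilpotent_iff_lowerCentralSeries.2 ⟨n, ?_⟩
  rw [← Subgroup.map_top_of_surjective _ (QuotientGroup.mk'_surjective _),
    ← Subgroup.map_lowerCentralSeries, Subgroup.map_eq_bot_iff, QuotientGroup.ker_mk']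

theorem isAbelianByNilpotent_freeAbByNil (m n : ℕ) : IsAbelianByNilpotent (FreeAbByNil m n) := by
  have hnorm : ((freeGamma m n).map (QuotientGroup.mk' ⁅freeGamma m n, freeGamma m n⁆)).Normal :=
    Subgroup.Normal.map inferInstance _ (QuotientGroup.mk'_surjective _)
  refine ⟨_, hnorm, ⟨⟨?_⟩⟩, ?_⟩
  · rintro ⟨_, g, hg, rfl⟩ ⟨_, h, hh, rfl⟩
    refine Subtype.ext ?_
    change QuotientGroup.mk' _ g * QuotientGroup.mk' _ h
      = QuotientGroup.mk' _ h * QuotientGroup.mk' _ g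
    rw [← _root_.map_mul, ← _root_.map_mul]
    refine QuotientGroup.eq.2 ?_
    have := Subgroup.commutator_mem_commutator (inv_mem hh) (inv_mem hg)
    rwa [commutatorElement_def, inv_inv, inv_inv, mul_assoc, ← mul_inv_rev] at this
  · have := isNilpotent_quotient_lowerCentralSeries (G := FreeGroup (Fin m)) (n - 1)
    exact Group.nilpotent_of_mulEquiv (QuotientGroup.quotientQuotientEquivQuotient _ _
      (Subgroup.commutator_le_left _ _)).symm

theorem IsAbelianByNilpotent.isAmenableGroup {G : Type*} [Group G] (h : IsAbelianByNilpotent G) :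
    IsAmenableGroup G := by
  obtain ⟨N, hnorm, hN, hQ⟩ := h
  exact isAmenableGroup_of_normal N (isAmenableGroup_of_comm fun a b => hN.is_comm.comm a b)
    isAmenableGroup_of_isSolvable

theorem exists_freeAbByNil_hasGrowthRate_ge {m : ℕ} (a : Fin m) {r : ℝ} (hr : 0 < r)
    (h : r < 2 * m - 1) :
    ∃ n, 2 ≤ n ∧ ∃ ω : ℝ, HasGrowthRate (freeAbByNilGens m n) ω ∧ r ≤ ω := by
  obtain ⟨b, c, V, hc, hcard, hnorm, hexp, hV⟩ := exists_finset_exponentSum_eq a hr h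
  have hrb : 0 < r ^ b := pow_pos hr b
  -- The gain `|V| / r ^ b > 1` per factor, taken `s` times, outweighs the `2b + 2` extra letters of
  -- a block.
  obtain ⟨s, hs⟩ := pow_unbounded_of_one_lt (r ^ (2 * b + 2)) ((one_lt_div hrb).2 hcard)
  have hs' : r ^ ((s + 2) * b + 2) ≤ (V.card : ℝ) ^ s := by
    rw [div_pow, lt_div_iff₀ (pow_pos hrb s)] at hs
    refine le_trans (le_of_eq ?_) hs.le
    rw [← pow_mul, ← pow_add]
    congr 1
    ring
  obtain ⟨n, hn, hball⟩ := exists_pow_le_ncard_wordBall a V s hc hnorm hexp hV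
  refine ⟨n, hn, exists_hasGrowthRate_ge (finite_freeAbByNilGens m n) hr (L := (s + 2) * b + 2)
    (Nat.succ_pos _) fun k => ?_⟩
  refine (pow_le_pow_left₀ (pow_pos hr _).le hs' k).trans ?_
  exact_mod_cast hball k

end Main

theorem theorem3 :
    (∀ m : ℕ, 1 ≤ m → ∀ ε : ℝ, 0 < ε → ∃ n : ℕ, 2 ≤ n ∧
      (freeAbByNilGens m n).ncard = m ∧
      Subgroup.closure (freeAbByNilGens m n) = ⊤ ∧
      IsAmenableGroup (FreeAbByNil m n) ∧
      IsAbelianByNilpotent (FreeAbByNil m n) ∧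
      ∃ ω : ℝ, HasGrowthRate (freeAbByNilGens m n) ω ∧ 2 * (m : ℝ) - 1 - ε ≤ ω) ∧
    (∀ m : ℕ, 2 ≤ m → ¬ ∃ c : ℝ, 1 < c ∧ c < 2 * (m : ℝ) - 1 ∧
      ∀ (G : Type) [Group G] (A : Set G), A.Finite → A.ncard = m → Subgroup.closure A = ⊤ →
        ∀ ω : ℝ, HasGrowthRate A ω → c ≤ ω → ¬ IsAmenableGroup G) := by
  have key : ∀ m : ℕ, 1 ≤ m → ∀ ε : ℝ, 0 < ε → ∃ n : ℕ, 2 ≤ n ∧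
      (freeAbByNilGens m n).ncard = m ∧
      Subgroup.closure (freeAbByNilGens m n) = ⊤ ∧
      IsAmenableGroup (FreeAbByNil m n) ∧
      IsAbelianByNilpotent (FreeAbByNil m n) ∧
      ∃ ω : ℝ, HasGrowthRate (freeAbByNilGens m n) ω ∧ 2 * (m : ℝ) - 1 - ε ≤ ω := by
    intro m hm ε hε
    have hm' : (1 : ℝ) ≤ m := by exact_mod_cast hm
    obtain ⟨n, hn, ω, hω, hle⟩ := exists_freeAbByNil_hasGrowthRate_ge (⟨0, hm⟩ : Fin m)
      -- The `1 / 2` keeps `r` positive when `ε` is large; it is below `2m - 1` because `m ≥ 1`.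
      (r := max (2 * (m : ℝ) - 1 - ε) (1 / 2)) (lt_max_of_lt_right (by norm_num))
      (max_lt (by linarith) (by linarith))
    exact ⟨n, hn, ncard_freeAbByNilGens hn, closure_freeAbByNilGens m n,
      (isAbelianByNilpotent_freeAbByNil m n).isAmenableGroup,
      isAbelianByNilpotent_freeAbByNil m n, ω, hω, (le_max_left _ _).trans hle⟩
  refine ⟨key, ?_⟩
  rintro m hm ⟨c, -, hc, h⟩
  obtain ⟨n, -, hcard, hclosure, hamen, -, ω, hω, hle⟩ :=
    key m (by omega) (2 * (m : ℝ) - 1 - c) (by linarith)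
  exact h (FreeAbByNil m n) _ (finite_freeAbByNilGens m n) hcard hclosure ω hω (by linarith) hamen
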